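/- Let $E$ be a finite set and $\mathcal{L}\subseteq 2^E$. For $e\in E$ the toggle $t_e:\mathcal{L}\to\mathcal{L}$ is defined by $t_e(X)=X\cup\{e\}$ if $e\notin X$ and $X\cup\{e\}\in\mathcal{L}$, $t_e(X)=X\setminus\{e\}$ if $e\in X$ and $X\setminus\{e\}\in\mathcal{L}$, and $t_e(X)=X$ otherwise. Each $t_e$ is an involution, and the toggle group $T(\mathcal{L})$ is the subgroup of the symmetric group $\mathfrak{S}_{\mathcal{L}}$ generated by $\{t_e \mid e\in E\}$. Let $G$ be a finite simple graph with vertex set $V$. Let $\mathcal{VC}(G)\subseteq 2^{V}$ be the set of vertex covers of $G$, that is, of sets of vertices containing at least one endpoint of every edge of $G$. Then: (1) If $G$ is connected, $T(\mathcal{VC}(G))$ is either the whole symmetric group or the alternating group on the set $\mathcal{VC}(G)$. (2) If $G$ has connected components $G_1,\dots,G_k$, then $$T(\mathcal{VC}(G))\cong T(\mathcal{VC}(G_1))\times T(\mathcal{VC}(G_2))\times\cdots\times T(\mathcal{VC}(G_k)),$$ by an isomorphism that, for every $i$ and every vertex $v$ of $G_i$, sends the toggle $t_v\in T(\mathcal{VC}(G))$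 to the tuple whose $i$-th entry is the toggle $t_v\in T(\mathcal{VC}(G_i))$ and whose other entries are the identity. -/

import Mathlib

namespace ToggleGroup

variable {E : Type*}

open Classical in
/-- The toggle `t_e` of `e : E` on a family `L` of subsets of `E`, as a map `L → L`. -/
noncomputable def toggleFun (L : Set (Set E)) (e : E) (X : L) : L :=
  if h : e ∉ (X : Set E) ∧ (X : Set E) ∪ {e} ∈ L then ⟨(X : Set E) ∪ {e}, h.2⟩
  else if h : e ∈ (X : Set E) ∧ (X : Set E) \ {e} ∈ L then ⟨(X : Set E) \ {e}, h.2⟩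
  else X

theorem toggleFun_involutive (L : Set (Set E)) (e : E) :
    Function.Involutive (toggleFun L e) := by
  rintro ⟨X, hX⟩
  by_cases he : e ∈ X
  · by_cases h : X \ {e} ∈ L
    · have h1 : X \ {e} ∪ {e} = X := by
        rw [Set.sdiff_union_self, Set.union_eq_self_of_subset_right (by simpa using he)]
      have h2 : toggleFun L e ⟨X, hX⟩ = ⟨X \ {e}, h⟩ := by simp [toggleFun, he, h]
      rw [h2]
      unfold toggleFun
      rw [dif_pos ⟨by simp, by simpa only [h1] using hX⟩]
      exact Subtype.ext h1
    · simp [toggleFun, he, h]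
  · by_cases h : X ∪ {e} ∈ L
    · have h1 : (X ∪ {e}) \ {e} = X := by
        rw [Set.union_sdiff_right, Set.sdiff_singleton_eq_self he]
      have h2 : toggleFun L e ⟨X, hX⟩ = ⟨X ∪ {e}, h⟩ := by
        unfold toggleFun
        rw [dif_pos ⟨he, h⟩]
      rw [h2]
      unfold toggleFun
      rw [dif_neg (by simp), dif_pos ⟨by simp, by simpa only [h1] using hX⟩]
      exact Subtype.ext h1
    · have h2 : toggleFun L e ⟨X, hX⟩ = ⟨X, hX⟩ := by
        unfold toggleFun
        rw [dif_neg (fun k => h k.2), dif_neg (fun k => he k.1)]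
      rw [h2, h2]

/-- The toggle `t_e` as a permutation of the family `L`. -/
noncomputable def toggle (L : Set (Set E)) (e : E) : Equiv.Perm L :=
  (toggleFun_involutive L e).toPerm

/-- The (generalized) toggle group `T(L)`: the subgroup of the symmetric group on `L` generated
by all the toggles `t_e`, `e : E`. -/
def toggleGroup (L : Set (Set E)) : Subgroup (Equiv.Perm L) :=
  Subgroup.closure (Set.range (toggle L))

/-- The toggle `t_e`, as an element of the toggle group. -/
noncomputable def toggleGen (L : Set (Set E)) (e : E) : toggleGroup L :=
  ⟨toggle L e, Subgroup.subset_closure (Set.mem_range_self e)⟩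

/-- The family `VC(G)` of all vertex covers of the graph `G`. -/
def vertexCovers {V : Type*} (G : SimpleGraph V) : Set (Set V) :=
  {X | G.IsVertexCover X}

end ToggleGroup

/-!
Connected case: remove a vertex `v` for which `G - v` is connected and argue by induction. The
covers of `G - v` are the covers of `G` containing `v`, with `v` removed, and every element of
`T(VC(G - v))` lifts to `T(VC(G))`. These covers form more than half of `VC(G)`, so the transitive
group `T(VC(G))` is primitive because `T(VC(G - v))` is. If `w` is a neighbour of `v`, the toggle
`t_w` fixes every cover avoiding `v`; if `w` has a further neighbour `x`, it also fixes the cover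
`V ∖ {x}`, which contains `v`. The commutator of `t_w` with the lift of a suitable 3-cycle is then a
3-cycle of `VC(G)`, whatever the lift does on the covers avoiding `v`, and Jordan's theorem applies.

General case: a vertex cover of `G` is a tuple of vertex covers of the components, and a toggle acts
on a single coordinate; the product of the toggle groups acts faithfully on such tuples and is
generated by the toggles of the components.
-/

namespace ToggleGroup

open Equiv Equiv.Perm Function MulAction
open scoped symmDiff commutatorElement

section PermutationGroups

variable {α β : Type*}

theorem conj_eq_conj_of_eqOn_support {g h σ : Perm α} (hgh : ∀ x, σ x ≠ x → g x = h x) :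
    g * σ * g⁻¹ = h * σ * h⁻¹ := by
  have hdisj : Disjoint (h⁻¹ * g) σ := fun x =>
    or_iff_not_imp_right.2 fun hx => by rw [mul_apply, hgh x hx, inv_eq_iff_eq]
  have hcomm : h⁻¹ * g * σ * g⁻¹ * h = σ := by
    rw [hdisj.commute.eq]
    group
  calc g * σ * g⁻¹ = h * (h⁻¹ * g * σ * g⁻¹ * h) * h⁻¹ := by group
    _ = h * σ * h⁻¹ := by rw [hcomm]

theorem isThreeCycle_commutator_of_involutive [Fintype α] [DecidableEq α] {σ : Perm α}
    (hσ : Involutive σ) {a c : α} (ha : σ a ≠ a) (hc : σ c = c) :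
    IsThreeCycle ⁅swap a c * swap a (σ a), σ⁆ := by
  have hca : c ≠ a := fun h => ha (h ▸ hc)
  have hcb : c ≠ σ a := fun h => hca (by rw [← hσ a, ← h, hc])
  have hcomm : ⁅swap a c * swap a (σ a), σ⁆ = swap c a * swap c (σ a) := by
    calc ⁅swap a c * swap a (σ a), σ⁆
      _ = swap a c * swap a (σ a) * (σ * swap a (σ a) * σ⁻¹) * (σ * swap a c * σ⁻¹) := by
        rw [commutatorElement_def, mul_inv_rev, swap_inv, swap_inv]
        group
      _ = swap a c * swap a (σ a) * swap a (σ a) * swap c (σ a) := by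
        rw [← swap_apply_apply, ← swap_apply_apply, hσ, hc, swap_comm (σ a) a, swap_comm (σ a) c]
      _ = swap c a * swap c (σ a) := by rw [mul_swap_mul_self, swap_comm a c]
  rw [hcomm]
  exact isThreeCycle_swap_mul_swap_same hca hcb ha.symm

theorem exists_semiconj_of_mem_closure {f : α → β} {s : Set (Perm α)} {U : Subgroup (Perm β)}
    (hs : ∀ g ∈ s, ∃ h ∈ U, Semiconj f g h) :
    ∀ g ∈ Subgroup.closure s, ∃ h ∈ U, Semiconj f g h := by
  intro g hg
  induction hg using Subgroup.closure_induction with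
  | mem g hg => exact hs g hg
  | one => exact ⟨1, one_mem U, fun _ => rfl⟩
  | mul g₁ g₂ _ _ ih₁ ih₂ =>
    obtain ⟨h₁, hh₁, hf₁⟩ := ih₁
    obtain ⟨h₂, hh₂, hf₂⟩ := ih₂
    exact ⟨h₁ * h₂, mul_mem hh₁ hh₂, hf₁.comp_right hf₂⟩
  | inv g _ ih =>
    obtain ⟨h, hh, hf⟩ := ih
    exact ⟨h⁻¹, inv_mem hh, fun x => by
      rw [eq_inv_iff_eq, ← hf, ← mul_apply, mul_inv_cancel, one_apply]⟩

theorem isPreprimitive_of_semiconj [Finite β] {f : α ↪ β} {T : Subgroup (Perm α)}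
    {U : Subgroup (Perm β)} [IsPreprimitive T α] [IsPretransitive U β]
    (hlift : ∀ g ∈ T, ∃ h ∈ U, Semiconj f g h) (hcard : Nat.card β < 2 * Nat.card α) :
    IsPreprimitive U β := by
  choose! h hU hf using hlift
  let φ : T → U := fun g => ⟨h g, hU g g.2⟩
  let F : α →ₑ[φ] β := ⟨f, fun g => hf g g.2⟩
  have hrange : (Set.range F).ncard = Nat.card α := Nat.card_range_of_injective f.injective
  exact IsPreprimitive.of_card_lt (f := F) (hrange ▸ hcard)

variable [Fintype α] [DecidableEq α] {T : Subgroup (Perm α)}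

theorem isPreprimitive_of_alternatingGroup_le [IsPretransitive T α]
    (hT : alternatingGroup α ≤ T) : IsPreprimitive T α := by
  rcases le_or_gt (Nat.card α) 2 with h2 | h3
  · exact ⟨fun {B} _ => isTrivialBlock_of_card_le_two h2 B⟩
  · have := alternatingGroup.isPreprimitive_of_three_le_card α h3
    let f : α →ₑ[Subgroup.inclusion hT] α := ⟨id, fun _ _ => rfl⟩
    exact IsPreprimitive.of_surjective (f := f) surjective_id

theorem alternatingGroup_le_of_isPretransitive_of_card_le_three [IsPretransitive T α]
    (h3 : Nat.card α ≤ 3) : alternatingGroup α ≤ T := by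
  apply IsMultiplyPretransitive.alternatingGroup_le
  obtain h | h : Nat.card α - 2 = 0 ∨ Nat.card α - 2 = 1 := by omega
  · rw [h]
    exact is_zero_pretransitive'
  · rw [h]
    exact is_one_pretransitive_iff.2 ‹_›

theorem eq_top_or_eq_alternatingGroup (hT : alternatingGroup α ≤ T) :
    T = ⊤ ∨ T = alternatingGroup α := by
  nontriviality α using Subsingleton.elim T ⊤
  have hindex : T.index ∣ 2 := alternatingGroup.index_eq_two (α := α) ▸ Subgroup.index_dvd_of_le hT
  exact ((Nat.dvd_prime Nat.prime_two).1 hindex).imp Subgroup.index_eq_one.1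
    eq_alternatingGroup_of_index_eq_two

theorem alternatingGroup_le_of_semiconj [Fintype β] [DecidableEq β] {f : α ↪ β}
    {U : Subgroup (Perm β)} [IsPreprimitive U β] (hT : alternatingGroup α ≤ T)
    (hlift : ∀ g ∈ T, ∃ h ∈ U, Semiconj f g h) {σ : Perm β} (hσU : σ ∈ U) (hσ : Involutive σ)
    (hσ_ne : σ ≠ 1) (hσf : ∀ y ∉ Set.range f, σ y = y) {c : α} (hc : σ (f c) = f c) :
    alternatingGroup β ≤ U := by
  have hmem_range : ∀ y, σ y ≠ y → y ∈ Set.range f := fun y => not_imp_comm.1 (hσf y)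
  obtain ⟨y, hy⟩ : ∃ y, σ y ≠ y := by
    simpa [Perm.ext_iff] using hσ_ne
  obtain ⟨a, rfl⟩ := hmem_range y hy
  obtain ⟨b, hb⟩ := hmem_range (σ (f a)) (by rwa [hσ, ne_comm])
  have hthree : IsThreeCycle ⁅swap (f a) (f c) * swap (f a) (σ (f a)), σ⁆ :=
    isThreeCycle_commutator_of_involutive hσ hy hc
  have hac : a ≠ c := by
    rintro rfl
    exact hy hc
  have hab : a ≠ b := by
    rintro rfl
    exact hy hb.symm
  have hcb : c ≠ b := by
    rintro rfl
    exact hac (f.injective (σ.injective (hb.symm.trans hc.symm)))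
  obtain ⟨h, hhU, hhf⟩ :=
    hlift _ (hT (isThreeCycle_swap_mul_swap_same hac hab hcb).mem_alternatingGroup)
  -- `h` agrees with the transported 3-cycle on the range of `f`, which contains the support of `σ`.
  have hcomm : ⁅h, σ⁆ = ⁅swap (f a) (f c) * swap (f a) (σ (f a)), σ⁆ := by
    rw [commutatorElement_def, commutatorElement_def, conj_eq_conj_of_eqOn_support]
    intro y hy
    obtain ⟨x, rfl⟩ := hmem_range y hy
    rw [← hhf, ← hb, mul_apply, mul_apply, f.swap_apply, f.swap_apply]
  refine alternatingGroup_le_of_isPreprimitive_of_isThreeCycle_mem ‹_› hthree (hcomm ▸ ?_)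
  exact mul_mem (mul_mem (mul_mem hhU hσU) (inv_mem hhU)) (inv_mem hσU)

end PermutationGroups

section Families

variable {E E' : Type*} {L : Set (Set E)} {L' : Set (Set E')} {e : E} {X : L}

theorem coe_toggle_of_mem (h : (X : Set E) ∆ {e} ∈ L) :
    (toggle L e X : Set E) = (X : Set E) ∆ {e} := by
  change (toggleFun L e X : Set E) = _
  by_cases he : e ∈ (X : Set E)
  · have heq : (X : Set E) ∆ {e} = (X : Set E) \ {e} := by grind
    rw [heq] at h ⊢
    rw [toggleFun, dif_neg (fun k => k.1 he), dif_pos ⟨he, h⟩]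
  · have heq : (X : Set E) ∆ {e} = (X : Set E) ∪ {e} := by grind
    rw [heq] at h ⊢
    rw [toggleFun, dif_pos ⟨he, h⟩]

theorem toggle_eq_self (h : (X : Set E) ∆ {e} ∉ L) : toggle L e X = X := by
  change toggleFun L e X = X
  rw [toggleFun, dif_neg, dif_neg]
  · rintro ⟨he, hX⟩
    exact h (by convert hX using 1; grind)
  · rintro ⟨he, hX⟩
    exact h (by convert hX using 1; grind)

theorem mem_toggle_iff_of_ne {x : E} (hx : x ≠ e) :
    x ∈ (toggle L e X : Set E) ↔ x ∈ (X : Set E) := by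
  by_cases h : (X : Set E) ∆ {e} ∈ L
  · rw [coe_toggle_of_mem h]
    grind
  · rw [toggle_eq_self h]

theorem toggle_mem_toggleGroup (L : Set (Set E)) (e : E) : toggle L e ∈ toggleGroup L :=
  (toggleGen L e).2

theorem preimage_toggle {j : E' → E} (hj : Injective j) {Y : L'} (hXY : j ⁻¹' (X : Set E) = Y)
    {e' : E'} (h : (X : Set E) ∆ {j e'} ∈ L ↔ (Y : Set E') ∆ {e'} ∈ L') :
    j ⁻¹' (toggle L (j e') X : Set E) = (toggle L' e' Y : Set E') := by
  by_cases hX : (X : Set E) ∆ {j e'} ∈ L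
  · rw [coe_toggle_of_mem hX, coe_toggle_of_mem (h.1 hX), Set.preimage_symmDiff, hXY,
      ← Set.image_singleton, hj.preimage_image]
  · rw [toggle_eq_self hX, toggle_eq_self (fun hY => hX (h.2 hY)), hXY]

end Families

section UpperSets

variable {E : Type*} {L : Set (Set E)}

theorem symmDiff_singleton_mem_of_notMem (hL : IsUpperSet L) {e : E} {X : Set E} (hX : X ∈ L)
    (he : e ∉ X) : X ∆ {e} ∈ L :=
  hL (by intro x hx; grind) hX

theorem isPretransitive_toggleGroup_of_isUpperSet [Finite L] (hL : IsUpperSet L) :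
    IsPretransitive (toggleGroup L) L := by
  rcases isEmpty_or_nonempty L with hempty | ⟨⟨X₀, hX₀⟩⟩
  · exact ⟨fun X => isEmptyElim X⟩
  let U : L := ⟨Set.univ, hL (Set.subset_univ X₀) hX₀⟩
  suffices h : ∀ X : L, X ∈ orbit (toggleGroup L) U from (isPretransitive_iff_base U).2 h
  intro X
  induction X using WellFoundedGT.induction with
  | ind X ih =>
    by_cases hX : (X : Set E) = Set.univ
    · rw [show X = U from Subtype.ext hX]
      exact mem_orbit_self U
    · obtain ⟨e, he⟩ := (Set.ne_univ_iff_exists_notMem _).1 hX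
      have hcoe := coe_toggle_of_mem (symmDiff_singleton_mem_of_notMem hL X.2 he)
      have hlt : X < toggle L e X := by
        rw [← Subtype.coe_lt_coe, hcoe]
        exact ⟨by grind, fun h => he (h (Or.inr ⟨rfl, he⟩))⟩
      have hmem : toggleGen L e • X ∈ orbit (toggleGroup L) U := ih _ hlt
      rwa [← orbit_eq_iff, orbit_smul, orbit_eq_iff] at hmem

/- The toggle of `v` injects the members of `L` avoiding `v` into those containing `v`, and misses
`X₀` since it fixes it. -/
theorem card_lt_two_mul_card_mem [Finite L] (hL : IsUpperSet L) {v : E} {X₀ : L}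
    (hv : v ∈ (X₀ : Set E)) (hX₀ : (X₀ : Set E) ∆ {v} ∉ L) :
    Nat.card L < 2 * Nat.card {X : L // v ∈ (X : Set E)} := by
  let R : Set L := {X | v ∈ (X : Set E)}
  have hssub : toggle L v '' Rᶜ ⊂ R := by
    refine (Set.ssubset_iff_of_subset ?_).2 ⟨X₀, hv, ?_⟩
    · rintro _ ⟨X, hX, rfl⟩
      change v ∈ (toggle L v X : Set E)
      rw [coe_toggle_of_mem (symmDiff_singleton_mem_of_notMem hL X.2 hX)]
      exact Or.inr ⟨rfl, hX⟩
    · rintro ⟨X, hX, hXX₀⟩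
      rw [← toggle_eq_self hX₀, (toggle L v).injective.eq_iff] at hXX₀
      exact hX (hXX₀ ▸ hv)
  have hlt : Rᶜ.ncard < R.ncard := by
    rw [← Set.ncard_image_of_injective Rᶜ (toggle L v).injective]
    exact Set.ncard_lt_ncard hssub
  have hadd := Set.ncard_add_ncard_compl R
  change _ < 2 * R.ncard
  omega

end UpperSets

section Contraction

variable {E : Type*} {L : Set (Set E)} {v : E}

/-- The contraction `L / v`: the members of `L` that contain `v`, with `v` removed, as a family of
subsets of `E ∖ {v}`. -/
def contraction (L : Set (Set E)) (v : E) : Set (Set ({v}ᶜ : Set E)) :=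
  {Y | insert v (Subtype.val '' Y) ∈ L}

theorem insert_image_preimage_val {X : Set E} (hv : v ∈ X) :
    insert v (Subtype.val '' (Subtype.val ⁻¹' X : Set ({v}ᶜ : Set E))) = X := by
  rw [Subtype.image_preimage_coe, Set.insert_eq, Set.union_inter_distrib_left, Set.union_compl_self,
    Set.univ_inter, Set.union_eq_self_of_subset_left (Set.singleton_subset_iff.2 hv)]

theorem preimage_val_insert_image (Y : Set ({v}ᶜ : Set E)) :
    Subtype.val ⁻¹' (insert v (Subtype.val '' Y)) = Y := by
  rw [Set.insert_eq, Set.preimage_union, Set.preimage_image_eq _ Subtype.val_injective,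
    Set.union_eq_right]
  exact fun x hx => absurd hx x.2

/-- The contraction `L / v` embedded in `L` by putting `v` back. -/
def contractionEmbedding (L : Set (Set E)) (v : E) : contraction L v ↪ L where
  toFun Y := ⟨insert v (Subtype.val '' (Y : Set ({v}ᶜ : Set E))), Y.2⟩
  inj' _ _ h := Subtype.ext <|
    LeftInverse.injective (g := (Subtype.val ⁻¹' ·)) preimage_val_insert_image (Subtype.ext_iff.1 h)

theorem range_contractionEmbedding :
    Set.range (contractionEmbedding L v) = {X : L | v ∈ (X : Set E)} := by
  refine Set.Subset.antisymm (Set.range_subset_iff.2 fun Y => Set.mem_insert v _) fun X hX => ?_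
  have heq := insert_image_preimage_val (X := (X : Set E)) hX
  exact ⟨⟨Subtype.val ⁻¹' (X : Set E), (congrArg (· ∈ L) heq).mpr X.2⟩, Subtype.ext heq⟩

theorem card_contraction (L : Set (Set E)) (v : E) :
    Nat.card (contraction L v) = Nat.card {X : L // v ∈ (X : Set E)} := by
  rw [← Nat.card_range_of_injective (contractionEmbedding L v).injective,
    range_contractionEmbedding]
  rfl

theorem semiconj_contractionEmbedding_toggle (e : ({v}ᶜ : Set E)) :
    Semiconj (contractionEmbedding L v) (toggle (contraction L v) e) (toggle L e) := by
  intro Y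
  have hsymm : (contractionEmbedding L v Y : Set E) ∆ {(e : E)} =
      insert v (Subtype.val '' ((Y : Set ({v}ᶜ : Set E)) ∆ {e})) := by
    have hne : (e : E) ≠ v := e.2
    rw [Set.image_symmDiff Subtype.val_injective, Set.image_singleton]
    change insert v (Subtype.val '' (Y : Set ({v}ᶜ : Set E))) ∆ {(e : E)} = _
    grind
  have hpre := preimage_toggle (X := contractionEmbedding L v Y) Subtype.val_injective
    (preimage_val_insert_image _) (e' := e) (by rw [hsymm]; rfl)
  have hv : v ∈ (toggle L e (contractionEmbedding L v Y) : Set E) :=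
    (mem_toggle_iff_of_ne (Ne.symm e.2)).2 (Set.mem_insert v _)
  refine Subtype.ext ?_
  change insert v (Subtype.val '' _) = _
  rw [← hpre, insert_image_preimage_val hv]

theorem isUpperSet_contraction (hL : IsUpperSet L) : IsUpperSet (contraction L v) :=
  fun _ _ hle => hL (Set.insert_subset_insert (Set.image_mono hle))

theorem alternatingGroup_le_toggleGroup_of_contraction [Fintype L] [DecidableEq L]
    [Fintype (contraction L v)] [DecidableEq (contraction L v)] (hL : IsUpperSet L)
    (hT : alternatingGroup (contraction L v) ≤ toggleGroup (contraction L v))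
    {X₀ : L} (hX₀ : v ∈ (X₀ : Set E)) (hX₀v : (X₀ : Set E) ∆ {v} ∉ L)
    {w : E} (hw : toggle L w ≠ 1) (hwv : ∀ X : L, v ∉ (X : Set E) → toggle L w X = X)
    {X₁ : L} (hX₁ : v ∈ (X₁ : Set E)) (hX₁w : toggle L w X₁ = X₁) :
    alternatingGroup L ≤ toggleGroup L := by
  have hlift : ∀ g ∈ toggleGroup (contraction L v),
      ∃ h ∈ toggleGroup L, Semiconj (contractionEmbedding L v) g h :=
    exists_semiconj_of_mem_closure <| Set.forall_mem_range.2 fun e =>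
      ⟨toggle L e, toggle_mem_toggleGroup L e, semiconj_contractionEmbedding_toggle e⟩
  have := isPretransitive_toggleGroup_of_isUpperSet hL
  have := isPretransitive_toggleGroup_of_isUpperSet (isUpperSet_contraction (v := v) hL)
  have := isPreprimitive_of_alternatingGroup_le hT
  have hcard := card_lt_two_mul_card_mem hL hX₀ hX₀v
  rw [← card_contraction] at hcard
  have := isPreprimitive_of_semiconj hlift hcard
  obtain ⟨Y, rfl⟩ : X₁ ∈ Set.range (contractionEmbedding L v) := by
    rwa [range_contractionEmbedding]
  refine alternatingGroup_le_of_semiconj hT hlift (toggle_mem_toggleGroup L w)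
    (toggleFun_involutive L w) hw ?_ hX₁w
  rwa [range_contractionEmbedding]

end Contraction

section Connected

variable {V : Type*} {G : SimpleGraph V}

theorem isUpperSet_vertexCovers : IsUpperSet (vertexCovers G) :=
  fun _ _ hle hX => hX.subset hle

theorem compl_singleton_mem_vertexCovers (v : V) : {v}ᶜ ∈ vertexCovers G := by
  intro x y hxy
  have := hxy.ne
  grind

theorem symmDiff_singleton_notMem_vertexCovers {v w : V} (hvw : G.Adj v w) {X : Set V}
    (hv : v ∉ X) (hw : w ∈ X) : X ∆ {w} ∉ vertexCovers G := by
  intro hX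
  have := hX hvw
  have := hvw.ne
  grind

theorem toggle_vertexCovers_eq_self {v w : V} (hvw : G.Adj v w) {X : vertexCovers G}
    (hv : v ∉ (X : Set V)) : toggle (vertexCovers G) w X = X :=
  toggle_eq_self (symmDiff_singleton_notMem_vertexCovers hvw hv ((X.2 hvw).resolve_left hv))

theorem toggle_vertexCovers_ne_one (w : V) : toggle (vertexCovers G) w ≠ 1 := by
  intro hone
  have hsymm : (Set.univ : Set V) ∆ {w} = {w}ᶜ := by grind
  have hcoe := coe_toggle_of_mem (X := ⟨Set.univ, G.isVertexCover_univ⟩)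
    (hsymm ▸ compl_singleton_mem_vertexCovers (G := G) w)
  rw [hone, hsymm] at hcoe
  exact (Set.ext_iff.1 hcoe w).1 (Set.mem_univ w) rfl

theorem vertexCovers_induce_compl_singleton (v : V) :
    vertexCovers (G.induce {v}ᶜ) = contraction (vertexCovers G) v := by
  ext Y
  refine ⟨fun hY x y hxy => ?_, fun hY x y hxy => ?_⟩
  · by_cases hx : x = v
    · exact Or.inl (Or.inl hx)
    by_cases hy : y = v
    · exact Or.inr (Or.inl hy)
    exact (hY (v := ⟨x, hx⟩) (w := ⟨y, hy⟩) hxy).imp (fun h => Or.inr ⟨_, h, rfl⟩)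
      fun h => Or.inr ⟨_, h, rfl⟩
  · rw [← preimage_val_insert_image Y]
    exact hY hxy

theorem card_family_le_two [Subsingleton V] (L : Set (Set V)) : Nat.card L ≤ 2 := by
  have := Fintype.ofFinite V
  calc Nat.card L ≤ Nat.card (Set V) := Finite.card_subtype_le _
    _ = 2 ^ Fintype.card V := by rw [Nat.card_eq_fintype_card, Fintype.card_set]
    _ ≤ 2 ^ 1 := Nat.pow_le_pow_right two_pos (Fintype.card_le_one_iff_subsingleton.2 ‹_›)

variable [Fintype (vertexCovers G)] [DecidableEq (vertexCovers G)]

theorem alternatingGroup_le_toggleGroup_vertexCovers_of_card_le_three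
    (h3 : Nat.card (vertexCovers G) ≤ 3) :
    alternatingGroup (vertexCovers G) ≤ toggleGroup (vertexCovers G) := by
  have := isPretransitive_toggleGroup_of_isUpperSet (isUpperSet_vertexCovers (G := G))
  exact alternatingGroup_le_of_isPretransitive_of_card_le_three h3

theorem alternatingGroup_le_toggleGroup_vertexCovers_of_contraction {v w : V} (hvw : G.Adj v w)
    (hGv : (G.induce {v}ᶜ).Connected) [Fintype (contraction (vertexCovers G) v)]
    [DecidableEq (contraction (vertexCovers G) v)]
    (hT : alternatingGroup (contraction (vertexCovers G) v) ≤
      toggleGroup (contraction (vertexCovers G) v)) :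
    alternatingGroup (vertexCovers G) ≤ toggleGroup (vertexCovers G) := by
  let C (x : V) : vertexCovers G := ⟨{x}ᶜ, compl_singleton_mem_vertexCovers x⟩
  have hCw : (C w : Set V) ∆ {v} ∉ vertexCovers G :=
    symmDiff_singleton_notMem_vertexCovers hvw.symm (by simp [C]) hvw.ne
  rcases subsingleton_or_nontrivial ({v}ᶜ : Set V) with hsub | hnontriv
  · apply alternatingGroup_le_toggleGroup_vertexCovers_of_card_le_three
    have hlt := card_lt_two_mul_card_mem isUpperSet_vertexCovers (X₀ := C w) hvw.ne hCw
    rw [← card_contraction] at hlt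
    have := card_family_le_two (contraction (vertexCovers G) v)
    omega
  · obtain ⟨⟨x, hxv⟩, hwx⟩ := hGv.preconnected.exists_adj_of_nontrivial ⟨w, hvw.ne'⟩
    have hxw : G.Adj x w := hwx.symm
    exact alternatingGroup_le_toggleGroup_of_contraction isUpperSet_vertexCovers hT
      (X₀ := C w) hvw.ne hCw (toggle_vertexCovers_ne_one w)
      (fun _ => toggle_vertexCovers_eq_self hvw)
      (X₁ := C x) (Ne.symm hxv) (toggle_vertexCovers_eq_self hxw (by simp [C]))

theorem alternatingGroup_le_toggleGroup_vertexCovers [Finite V] (hG : G.Connected) :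
    alternatingGroup (vertexCovers G) ≤ toggleGroup (vertexCovers G) := by
  classical
  induction V using Finite.induction_subsingleton_or_nontrivial with
  | hbase V =>
    exact alternatingGroup_le_toggleGroup_vertexCovers_of_card_le_three
      ((card_family_le_two _).trans (by norm_num))
  | hstep V ih =>
    obtain ⟨v, hGv⟩ := hG.exists_connected_induce_compl_singleton_of_finite_nontrivial
    obtain ⟨w, hvw⟩ := hG.preconnected.exists_adj_of_nontrivial v
    have := Fintype.ofFinite (contraction (vertexCovers G) v)
    refine alternatingGroup_le_toggleGroup_vertexCovers_of_contraction hvw hGv ?_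
    have hT := @ih ({v}ᶜ : Set V) _ (Finite.card_subtype_lt (x := v) (by simp)) (G.induce {v}ᶜ)
    rw [vertexCovers_induce_compl_singleton] at hT
    exact hT hGv

end Connected

section Products

theorem closure_iUnion_mulSingle_image {ι : Type*} [Finite ι] [DecidableEq ι] {H : ι → Type*}
    [∀ i, Group (H i)] {s : ∀ i, Set (H i)} (hs : ∀ i, Subgroup.closure (s i) = ⊤) :
    Subgroup.closure (⋃ i, Pi.mulSingle i '' s i) = (⊤ : Subgroup (∀ i, H i)) := by
  rw [← top_le_iff, ← Subgroup.pi_top Set.univ, Subgroup.pi_le_iff]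
  intro i
  rw [← hs i, MonoidHom.map_closure]
  exact Subgroup.closure_mono (Set.subset_iUnion (fun i => Pi.mulSingle i '' s i) i)

theorem faithfulSMul_pi {ι : Type*} {H X : ι → Type*} [∀ i, SMul (H i) (X i)]
    [∀ i, FaithfulSMul (H i) (X i)] [∀ i, Nonempty (X i)] :
    FaithfulSMul (∀ i, H i) (∀ i, X i) := by
  classical
  refine ⟨fun {g h} hgh => funext fun i => FaithfulSMul.eq_of_smul_eq_smul (α := X i) fun x => ?_⟩
  simpa using congrFun (hgh (update (fun _ => Classical.arbitrary _) i x)) i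

theorem closure_range_toggleGen {E : Type*} (L : Set (Set E)) :
    Subgroup.closure (Set.range (toggleGen L)) = ⊤ := by
  have hrange : Set.range (toggleGen L) = Subtype.val ⁻¹' Set.range (toggle L) := by
    ext g
    exact exists_congr fun e => Subtype.ext_iff
  rw [hrange]
  exact Subgroup.closure_closure_coe_preimage

variable {ι E : Type*} {F : ι → Type*} (e : (Σ i, F i) ≃ E) (M : ∀ i, Set (Set (F i)))

/-- The product of the families `M i`: the subsets of the disjoint union `E` of the sets `F i`
whose trace on each `F i` belongs to `M i`. The disjoint union is given by a bijection `e`. -/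
def productFamily : Set (Set E) :=
  {X | ∀ i, (fun a => e ⟨i, a⟩) ⁻¹' X ∈ M i}

theorem preimage_setOf_symm_mem (Y : ∀ i, Set (F i)) (i : ι) :
    (fun a => e ⟨i, a⟩) ⁻¹' {x | (e.symm x).2 ∈ Y (e.symm x).1} = Y i := by
  ext a
  change (e.symm (e ⟨i, a⟩)).2 ∈ Y (e.symm (e ⟨i, a⟩)).1 ↔ a ∈ Y i
  rw [e.symm_apply_apply]

/-- A member of a product of families corresponds to the tuple of its traces. -/
def productFamilyEquiv : productFamily e M ≃ ∀ i, M i where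
  toFun X i := ⟨(fun a => e ⟨i, a⟩) ⁻¹' X, X.2 i⟩
  invFun Y := ⟨{x | (e.symm x).2 ∈ (Y (e.symm x).1 : Set _)}, fun i => by
    rw [preimage_setOf_symm_mem e fun i => (Y i : Set _)]
    exact (Y i).2⟩
  left_inv X := by simp
  right_inv Y := funext fun i => Subtype.ext (preimage_setOf_symm_mem e (fun i => (Y i : Set _)) i)

/-- The coordinatewise action of the toggle groups of the `M i` on their product family. -/
def productHom : (∀ i, toggleGroup (M i)) →* Perm (productFamily e M) :=
  (productFamilyEquiv e M).symm.permCongrHom.toMonoidHom.comp (toPermHom _ (∀ i, M i))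

variable {e M}

theorem productHom_injective (hM : ∀ i, (M i).Nonempty) : Injective (productHom e M) := by
  have (i : ι) : Nonempty (M i) := (hM i).to_subtype
  have : FaithfulSMul (∀ i, toggleGroup (M i)) (∀ i, M i) := faithfulSMul_pi
  exact (productFamilyEquiv e M).symm.permCongrHom.injective.comp toPerm_injective

theorem symmDiff_singleton_mem_productFamily_iff {X : Set E} (hX : X ∈ productFamily e M) {i : ι}
    {a : F i} :
    X ∆ {e ⟨i, a⟩} ∈ productFamily e M ↔ ((fun b => e ⟨i, b⟩) ⁻¹' X) ∆ {a} ∈ M i := by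
  have hsame : (fun b => e ⟨i, b⟩) ⁻¹' (X ∆ {e ⟨i, a⟩}) = ((fun b => e ⟨i, b⟩) ⁻¹' X) ∆ {a} := by
    ext b
    simp [Set.mem_symmDiff]
  refine ⟨fun h => hsame ▸ h i, fun h j => ?_⟩
  by_cases hj : j = i
  · subst hj
    exact hsame ▸ h
  · have hother : (fun b => e ⟨j, b⟩) ⁻¹' (X ∆ {e ⟨i, a⟩}) = (fun b => e ⟨j, b⟩) ⁻¹' X := by
      ext b
      simp [Set.mem_symmDiff, hj]
    exact hother ▸ hX j

theorem productFamilyEquiv_toggle [DecidableEq ι] (X : productFamily e M) (i : ι) (a : F i) :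
    productFamilyEquiv e M (toggle _ (e ⟨i, a⟩) X) =
      (Pi.mulSingle i (toggleGen (M i) a) : ∀ i, toggleGroup (M i)) • productFamilyEquiv e M X := by
  funext j
  rw [Pi.smul_apply']
  refine Subtype.ext ?_
  by_cases hj : j = i
  · subst hj
    rw [Pi.mulSingle_eq_same]
    exact preimage_toggle (L' := M j) (Y := productFamilyEquiv e M X j)
      (e.injective.comp sigma_mk_injective) rfl (symmDiff_singleton_mem_productFamily_iff X.2)
  · rw [Pi.mulSingle_eq_of_ne hj, one_smul]
    ext b
    exact mem_toggle_iff_of_ne (by simp [hj])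

theorem productHom_mulSingle [DecidableEq ι] (i : ι) (a : F i) :
    productHom e M (Pi.mulSingle i (toggleGen (M i) a)) = toggle _ (e ⟨i, a⟩) := by
  ext1 X
  exact (productFamilyEquiv e M).symm_apply_eq.2 (productFamilyEquiv_toggle X i a).symm

theorem range_productHom [Finite ι] : (productHom e M).range = toggleGroup (productFamily e M) := by
  classical
  rw [MonoidHom.range_eq_map, toggleGroup,
    ← closure_iUnion_mulSingle_image fun i => closure_range_toggleGen (M i), MonoidHom.map_closure,
    ← e.surjective.range_comp, Set.range_sigma_eq_iUnion_range, Set.image_iUnion]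
  refine congrArg Subgroup.closure (Set.iUnion_congr fun i => ?_)
  rw [← Set.range_comp, ← Set.range_comp]
  exact congrArg Set.range (funext (productHom_mulSingle i))

theorem exists_toggleGroup_productFamily_mulEquiv_pi [Finite ι] [DecidableEq ι]
    (hM : ∀ i, (M i).Nonempty) :
    ∃ φ : toggleGroup (productFamily e M) ≃* ∀ i, toggleGroup (M i),
      ∀ i a, φ (toggleGen _ (e ⟨i, a⟩)) = Pi.mulSingle i (toggleGen (M i) a) := by
  refine ⟨((MonoidHom.ofInjective (productHom_injective hM)).trans
    (MulEquiv.subgroupCongr range_productHom)).symm, fun i a => ?_⟩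
  exact (MulEquiv.symm_apply_eq _).2 (Subtype.ext (productHom_mulSingle i a).symm)

end Products

section Components

variable {V : Type*} (G : SimpleGraph V)

theorem vertexCovers_eq_productFamily :
    vertexCovers G = productFamily (Equiv.sigmaFiberEquiv G.connectedComponentMk)
      fun C => vertexCovers C.toSimpleGraph := by
  ext X
  refine ⟨fun hX C a b hab => hX hab, fun hX a b hab => ?_⟩
  have hb : G.connectedComponentMk b = G.connectedComponentMk a :=
    SimpleGraph.ConnectedComponent.sound hab.symm.reachable
  exact hX (G.connectedComponentMk a) (v := ⟨a, rfl⟩) (w := ⟨b, hb⟩) hab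

theorem exists_toggleGroup_vertexCovers_mulEquiv_pi [Finite V] [DecidableEq G.ConnectedComponent] :
    ∃ φ : toggleGroup (vertexCovers G) ≃*
        ∀ C : G.ConnectedComponent, toggleGroup (vertexCovers C.toSimpleGraph),
      ∀ (C : G.ConnectedComponent) (v : C), φ (toggleGen (vertexCovers G) v) =
        Pi.mulSingle C (toggleGen (vertexCovers C.toSimpleGraph) v) := by
  rw [vertexCovers_eq_productFamily G]
  exact exists_toggleGroup_productFamily_mulEquiv_pi fun C =>
    ⟨Set.univ, C.toSimpleGraph.isVertexCover_univ⟩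

end Components

end ToggleGroup

theorem mainTheorem8 {V : Type*} [Finite V] (G : SimpleGraph V)
    [Fintype (ToggleGroup.vertexCovers G)] [DecidableEq (ToggleGroup.vertexCovers G)]
    [DecidableEq G.ConnectedComponent] :
    (G.Connected →
      ToggleGroup.toggleGroup (ToggleGroup.vertexCovers G) = ⊤ ∨
      ToggleGroup.toggleGroup (ToggleGroup.vertexCovers G) =
        alternatingGroup (ToggleGroup.vertexCovers G)) ∧
    (∃ φ : ToggleGroup.toggleGroup (ToggleGroup.vertexCovers G) ≃*
        ((C : G.ConnectedComponent) →
          ToggleGroup.toggleGroup (ToggleGroup.vertexCovers C.toSimpleGraph)),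
      ∀ (C : G.ConnectedComponent) (v : C),
        φ (ToggleGroup.toggleGen (ToggleGroup.vertexCovers G) (v : V)) =
          Pi.mulSingle C (ToggleGroup.toggleGen (ToggleGroup.vertexCovers C.toSimpleGraph) v)) :=
  ⟨fun hG => ToggleGroup.eq_top_or_eq_alternatingGroup
      (ToggleGroup.alternatingGroup_le_toggleGroup_vertexCovers hG),
    ToggleGroup.exists_toggleGroup_vertexCovers_mulEquiv_pi G⟩
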